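/- Let $n$ be a positive integer with $n=pq$, where $p,q$ are integers with $\gcd(p,q)=1$. Let $s,t\in\{1,\dots,n-1\}$ be such that none of $$2s,\ 2t,\ 2(s+t),\ 3s-t,\ 3t-s,\ 3s+t,\ 3t+s,\ 4s,\ 4t$$ is congruent to $0$ modulo $n$. Let $C_n(s,t)$ be the circulant graph with vertex set $\{1,\dots,n\}$ in which $x$ and $y$ are adjacent if and only if $x-y$ is congruent modulo $n$ to one of $s,-s,t,-t$. Let $\mathcal N(C_n(s,t))$ be its neighborhood complex, i.e. the simplicial complex whose vertices are the non-isolated vertices of the graph and whose simplices are the nonempty sets of vertices that have a common neighbor. If $$s=\frac{p-q}{2},\quad t=\frac{p+q}{2}\qquad\text{or}\qquad s=\frac{p^2-q}{2},\quad t=\frac{p^2+q}{2},$$ then (the geometric realization of) $\mathcal N(C_n(s,t))$ is homotopy equivalent to the torus $S^1\times S^1$. -/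

import Mathlib

/-- The neighborhood complex of a graph: its simplices are the nonempty finite sets of vertices
that have a common neighbor (so its vertices are exactly the non-isolated vertices of `G`). -/
def SimpleGraph.neighborhoodComplex {V : Type*} (G : SimpleGraph V) :
    PreAbstractSimplicialComplex V where
  faces := {σ | σ.Nonempty ∧ ∃ v, ∀ w ∈ σ, G.Adj v w}
  isRelLowerSet_faces := by
    rintro σ ⟨hne, v, hv⟩
    exact ⟨hne, fun τ hτ hτne => ⟨hτne, v, fun w hw => hv w (hτ hw)⟩⟩

/-- The geometric realization of a simplicial complex on a finite set `V` of potential vertices: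
the points of the standard simplex spanned by `V` (given by their barycentric coordinates)
that lie in the face spanned by some simplex of `K`, with the topology induced from `V → ℝ`. -/
def PreAbstractSimplicialComplex.realization {V : Type*} [Fintype V]
    (K : PreAbstractSimplicialComplex V) : Set (V → ℝ) :=
  {x | x ∈ stdSimplex ℝ V ∧ ∃ σ ∈ K.faces, ∀ v, x v ≠ 0 → v ∈ σ}

/-- The circulant graph `C_n(s, t)`, with the vertex set `{1, …, n}` taken as `ZMod n`: two
distinct vertices `x`, `y` are adjacent if and only if `x - y` is `s`, `t`, `-s` or `-t` mod `n`. -/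
def circulantGraphTwo (n s t : ℕ) : SimpleGraph (ZMod n) :=
  SimpleGraph.circulantGraph {(s : ZMod n), (t : ZMod n)}

/-! Put `a = s + t` and `b = t - s`. The neighbors of `v` are `v - t + {0, a, b, a + b}`, a
parallelogram spanned by `a` and `b`. Here `b = q` and `a` is `p` or `p ^ 2`, so by the Chinese
remainder theorem, after rescaling by units, `a` and `b` become the standard basis of `ZMod |q| ×
ZMod |p|` (`exists_addEquiv_prod`). Each neighborhood is then a product of two cycle edges, and the
neighborhood complex is the categorical product of two cycles (`neighborhoodComplexHomeomorph`). A
point of a categorical product is a joint distribution; taking marginals is a homotopy equivalence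
onto the product of realizations (`realizationProdHomotopyEquiv`). Each cycle has odd length other
than 1, hence at least 3, and realizes to a circle. -/

namespace PreAbstractSimplicialComplex

/-- The categorical product of two simplicial complexes: its simplices are the nonempty subsets
of products of simplices. -/
def prod {A B : Type*} (K : PreAbstractSimplicialComplex A) (L : PreAbstractSimplicialComplex B) :
    PreAbstractSimplicialComplex (A × B) where
  faces := {σ | σ.Nonempty ∧ ∃ α ∈ K.faces, ∃ β ∈ L.faces, σ ⊆ α ×ˢ β}
  isRelLowerSet_faces := by
    rintro σ ⟨hne, α, hα, β, hβ, h⟩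
    exact ⟨hne, fun τ hτ hτne => ⟨hτne, α, hα, β, hβ, hτ.trans h⟩⟩

theorem nonempty_of_mem_faces {A : Type*} (K : PreAbstractSimplicialComplex A) {σ : Finset A}
    (h : σ ∈ K.faces) : σ.Nonempty := (K.isRelLowerSet_faces h).1

theorem continuous_coordinate {V Z : Type*} [TopologicalSpace Z] {S : Set (V → ℝ)} {f : Z → S}
    (hf : Continuous f) (v : V) : Continuous fun z => (f z).1 v :=
  (continuous_apply v).comp (continuous_subtype_val.comp hf)

/-! ### Categorical products and marginals -/

section Product

variable {A B : Type*} [Fintype A] [Fintype B]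
  (K : PreAbstractSimplicialComplex A) (L : PreAbstractSimplicialComplex B)

theorem fst_marginal_mem {x : A × B → ℝ} (hx : x ∈ (K.prod L).realization) :
    (fun a => ∑ b, x (a, b)) ∈ K.realization := by
  obtain ⟨⟨h0, h1⟩, σ, ⟨-, α, hα, β, -, hσ⟩, hs⟩ := hx
  refine ⟨⟨fun a => Finset.sum_nonneg fun b _ => h0 _, ?_⟩, α, hα, fun a ha => ?_⟩
  · rw [← h1, Fintype.sum_prod_type]
  · obtain ⟨b, -, hb⟩ := Finset.exists_ne_zero_of_sum_ne_zero ha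
    exact (Finset.mem_product.1 (hσ (hs _ hb))).1

theorem snd_marginal_mem {x : A × B → ℝ} (hx : x ∈ (K.prod L).realization) :
    (fun b => ∑ a, x (a, b)) ∈ L.realization := by
  obtain ⟨⟨h0, h1⟩, σ, ⟨-, α, -, β, hβ, hσ⟩, hs⟩ := hx
  refine ⟨⟨fun a => Finset.sum_nonneg fun b _ => h0 _, ?_⟩, β, hβ, fun b hb => ?_⟩
  · rw [← h1, Fintype.sum_prod_type_right]
  · obtain ⟨a, -, ha⟩ := Finset.exists_ne_zero_of_sum_ne_zero hb
    exact (Finset.mem_product.1 (hσ (hs _ ha))).2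

theorem mul_mem_realization_prod {x : A → ℝ} {y : B → ℝ} (hx : x ∈ K.realization)
    (hy : y ∈ L.realization) :
    (fun c : A × B => x c.1 * y c.2) ∈ (K.prod L).realization := by
  obtain ⟨⟨hx0, hx1⟩, α, hα, hxs⟩ := hx
  obtain ⟨⟨hy0, hy1⟩, β, hβ, hys⟩ := hy
  refine ⟨⟨fun c => mul_nonneg (hx0 _) (hy0 _), ?_⟩, α ×ˢ β,
    ⟨(K.nonempty_of_mem_faces hα).product (L.nonempty_of_mem_faces hβ), α, hα, β, hβ, subset_rfl⟩,
    fun c hc => Finset.mem_product.2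
      ⟨hxs _ (left_ne_zero_of_mul hc), hys _ (right_ne_zero_of_mul hc)⟩⟩
  rw [Fintype.sum_prod_type, ← Fintype.sum_mul_sum, hx1, hy1, one_mul]

/-- The pair of marginals of a point in the realization of a product. -/
def marginals : C((K.prod L).realization, K.realization × L.realization) where
  toFun x := (⟨_, K.fst_marginal_mem L x.2⟩, ⟨_, K.snd_marginal_mem L x.2⟩)
  continuous_toFun :=
    (Continuous.subtype_mk (continuous_pi fun _ => continuous_finsetSum _ fun _ _ =>
      continuous_coordinate continuous_id _) _).prodMk
    (Continuous.subtype_mk (continuous_pi fun _ => continuous_finsetSum _ fun _ _ =>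
      continuous_coordinate continuous_id _) _)

/-- The product of two points, regarded as probability distributions on the vertices. -/
def productPoint : C(K.realization × L.realization, (K.prod L).realization) where
  toFun z := ⟨_, K.mul_mem_realization_prod L z.1.2 z.2.2⟩
  continuous_toFun := Continuous.subtype_mk (continuous_pi fun _ =>
    (continuous_coordinate continuous_fst _).mul (continuous_coordinate continuous_snd _)) _

theorem marginals_comp_productPoint :
    (K.marginals L).comp (K.productPoint L) = ContinuousMap.id _ := by
  ext z a
  · change ∑ b, z.1.1 a * z.2.1 b = z.1.1 a
    rw [← Finset.mul_sum, z.2.2.1.2, mul_one]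
  · change ∑ b, z.1.1 b * z.2.1 a = z.2.1 a
    rw [← Finset.sum_mul, z.1.2.1.2, one_mul]

/-- If `x` is supported in a box `α ×ˢ β`, so is the product of its marginals; the whole segment
between them lies in the simplex on that box. -/
theorem segment_productPoint_mem {x : A × B → ℝ} (hx : x ∈ (K.prod L).realization)
    (r : unitInterval) :
    (fun c => (1 - r : ℝ) * ((∑ b, x (c.1, b)) * ∑ a, x (a, c.2)) + r * x c) ∈
      (K.prod L).realization := by
  have hm := K.mul_mem_realization_prod L (K.fst_marginal_mem L hx) (K.snd_marginal_mem L hx)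
  refine ⟨convex_stdSimplex ℝ _ hm.1 hx.1 (sub_nonneg.2 r.2.2) r.2.1 (by ring), ?_⟩
  obtain ⟨⟨h0, -⟩, σ, ⟨-, α, hα, β, hβ, hσ⟩, hs⟩ := hx
  refine ⟨α ×ˢ β, ⟨(K.nonempty_of_mem_faces hα).product (L.nonempty_of_mem_faces hβ), α, hα, β, hβ,
    subset_rfl⟩, fun c hc => ?_⟩
  by_contra hcm
  have hz : x c = 0 := by_contra fun h => hcm (hσ (hs _ h))
  beta_reduce at hc
  rw [hz, mul_zero, add_zero] at hc
  have hc' := right_ne_zero_of_mul hc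
  obtain ⟨b, -, hb⟩ := Finset.exists_ne_zero_of_sum_ne_zero (left_ne_zero_of_mul hc')
  obtain ⟨a, -, ha⟩ := Finset.exists_ne_zero_of_sum_ne_zero (right_ne_zero_of_mul hc')
  exact hcm (Finset.mem_product.2
    ⟨(Finset.mem_product.1 (hσ (hs _ hb))).1, (Finset.mem_product.1 (hσ (hs _ ha))).2⟩)

/-- The straight-line homotopy from the product of the marginals to the identity. -/
def productPointMarginalsHomotopy :
    ContinuousMap.Homotopy ((K.productPoint L).comp (K.marginals L)) (ContinuousMap.id _) where
  toFun z := ⟨_, K.segment_productPoint_mem L z.2.2 z.1⟩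
  continuous_toFun := by
    have h : ∀ c, Continuous fun z : unitInterval × (K.prod L).realization => z.2.1 c :=
      continuous_coordinate continuous_snd
    exact Continuous.subtype_mk (continuous_pi fun c => by fun_prop) _
  map_zero_left x := by
    ext c
    simp [productPoint, marginals]
  map_one_left x := by
    ext c
    simp

/-- The realization of a categorical product is homotopy equivalent to the product of the
realizations. -/
def realizationProdHomotopyEquiv :
    ContinuousMap.HomotopyEquiv (K.prod L).realization (K.realization × L.realization) where
  toFun := K.marginals L
  invFun := K.productPoint L
  left_inv := ⟨K.productPointMarginalsHomotopy L⟩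
  right_inv := by rw [K.marginals_comp_productPoint L]

end Product

theorem mem_realization_comp_equiv {V W : Type*} [Fintype V] [Fintype W]
    {K : PreAbstractSimplicialComplex V} {L : PreAbstractSimplicialComplex W} (e : V ≃ W)
    (h : ∀ σ : Finset W, σ ∈ L.faces → σ.map e.symm.toEmbedding ∈ K.faces) {x : W → ℝ}
    (hx : x ∈ L.realization) : x ∘ e ∈ K.realization := by
  obtain ⟨⟨h0, h1⟩, σ, hσ, hs⟩ := hx
  refine ⟨⟨fun v => h0 _, (e.sum_comp x).trans h1⟩, _, h σ hσ, fun v hv => ?_⟩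
  exact Finset.mem_map.2 ⟨e v, hs _ hv, e.symm_apply_apply v⟩

/-- An isomorphism of simplicial complexes induces a homeomorphism of realizations. -/
def realizationCongr {V W : Type*} [Fintype V] [Fintype W]
    {K : PreAbstractSimplicialComplex V} {L : PreAbstractSimplicialComplex W} (e : V ≃ W)
    (h : ∀ σ : Finset V, σ ∈ K.faces → σ.map e.toEmbedding ∈ L.faces)
    (h' : ∀ σ : Finset W, σ ∈ L.faces → σ.map e.symm.toEmbedding ∈ K.faces) :
    K.realization ≃ₜ L.realization where
  toFun x := ⟨x.1 ∘ e.symm, mem_realization_comp_equiv e.symm h x.2⟩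
  invFun x := ⟨x.1 ∘ e, mem_realization_comp_equiv e h' x.2⟩
  left_inv x := by ext; simp
  right_inv x := by ext; simp
  continuous_toFun :=
    Continuous.subtype_mk (continuous_pi fun w => continuous_coordinate continuous_id _) _
  continuous_invFun :=
    Continuous.subtype_mk (continuous_pi fun w => continuous_coordinate continuous_id _) _

end PreAbstractSimplicialComplex

/-! ### Cycles and circles -/

/-- The cycle of length `m` as a simplicial complex: the simplices are the nonempty subsets of
the edges `{i, i + 1}`. -/
def cycleComplex (m : ℕ) : PreAbstractSimplicialComplex (ZMod m) where
  faces := {σ | σ.Nonempty ∧ ∃ i, ∀ k ∈ σ, k = i ∨ k = i + 1}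
  isRelLowerSet_faces := by
    rintro σ ⟨hne, i, hi⟩
    exact ⟨hne, fun τ hτ hτne => ⟨hτne, i, fun k hk => hi k (hτ hk)⟩⟩

namespace cycleComplex

variable {m : ℕ}

theorem coe_val_intCast [NeZero m] (j : ℤ) :
    ((((j : ZMod m).val : ℝ)) : AddCircle (m : ℝ)) = ((j : ℝ) : AddCircle (m : ℝ)) := by
  have h : (((j : ZMod m).val : ℤ)) = j - m * (j / m) := by
    rw [ZMod.val_intCast, Int.emod_def]
  have h' : ((j : ZMod m).val : ℝ) = (j : ℝ) - ((j / m : ℤ) : ℝ) * m := by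
    have := congrArg (Int.cast : ℤ → ℝ) h
    push_cast at this
    rw [this]; ring
  rw [h', AddCircle.coe_sub, ← zsmul_eq_mul, AddCircle.coe_zsmul, AddCircle.coe_period, smul_zero,
    sub_zero]

/-- The barycentric coordinates of the point with parameter `θ` on the cycle of length `m`:
the tent functions of radius one around the vertices. -/
noncomputable def tent (m : ℕ) (θ : AddCircle (m : ℝ)) (k : ZMod m) : ℝ :=
  max 0 (1 - ‖θ - ((k.val : ℝ) : AddCircle (m : ℝ))‖)

theorem continuous_tent : Continuous (tent m) := by
  unfold tent
  fun_prop

theorem tent_intCast [NeZero m] (x : ℝ) (j : ℤ) :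
    tent m (x : AddCircle (m : ℝ)) (j : ZMod m) =
      max 0 (1 - ‖((x - j : ℝ) : AddCircle (m : ℝ))‖) := by
  rw [tent, coe_val_intCast, AddCircle.coe_sub]

theorem norm_coe_of_abs_le_one (hm : 3 ≤ m) {x : ℝ} (hx : |x| ≤ 1) :
    ‖(x : AddCircle (m : ℝ))‖ = |x| := by
  have hm' : (3 : ℝ) ≤ m := by exact_mod_cast hm
  rw [AddCircle.norm_coe_eq_abs_iff]
  · rw [abs_of_nonneg (by linarith : (0 : ℝ) ≤ m)]; linarith
  · linarith

theorem exists_norm_coe_eq (x : ℝ) :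
    ∃ z : ℤ, ‖(x : AddCircle (m : ℝ))‖ = |x - z * m| :=
  ⟨_, AddCircle.norm_eq _⟩

theorem tent_left (hm : 3 ≤ m) [NeZero m] (i : ℤ) {u : ℝ} (h0 : 0 ≤ u) (h1 : u ≤ 1) :
    tent m ((i + u : ℝ) : AddCircle (m : ℝ)) (i : ZMod m) = 1 - u := by
  rw [tent_intCast, add_sub_cancel_left, norm_coe_of_abs_le_one hm (by rwa [abs_of_nonneg h0]),
    abs_of_nonneg h0, max_eq_right (by linarith)]

theorem tent_right (hm : 3 ≤ m) [NeZero m] (i : ℤ) {u : ℝ} (h0 : 0 ≤ u) (h1 : u ≤ 1) :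
    tent m ((i + u : ℝ) : AddCircle (m : ℝ)) ((i : ZMod m) + 1) = u := by
  have h : |u - 1| = 1 - u := by rw [abs_of_nonpos (by linarith)]; ring
  have := tent_intCast (m := m) (i + u) (i + 1)
  push_cast at this
  rw [this, show (i + u - (i + 1) : ℝ) = u - 1 by ring,
    norm_coe_of_abs_le_one hm (by rw [h]; linarith), h, sub_sub_cancel, max_eq_right h0]

theorem tent_eq_zero [NeZero m] (i : ℤ) {u : ℝ} (h0 : 0 ≤ u) (h1 : u ≤ 1) {k : ZMod m}
    (hk : k ≠ i) (hk' : k ≠ i + 1) : tent m ((i + u : ℝ) : AddCircle (m : ℝ)) k = 0 := by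
  obtain ⟨j, rfl⟩ := ZMod.intCast_surjective k
  rw [tent_intCast]
  refine max_eq_left (sub_nonpos.2 ?_)
  obtain ⟨z, hz⟩ := exists_norm_coe_eq (m := m) (i + u - j)
  rw [hz]
  -- The representative of `k` realizing the distance is an integer at most `i - 1` or at least `i +
  -- 2`, so it is at least 1 away from `i + u`.
  have hne : j + z * m ≠ i := fun h => hk (by rw [← h]; simp)
  have hne' : j + z * m ≠ i + 1 := fun h => hk' (by
    have := congrArg (Int.cast : ℤ → ZMod m) h
    simpa using this)
  rcases lt_or_gt_of_ne hne with h | h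
  · have : ((j + z * m : ℤ) : ℝ) + 1 ≤ i := by exact_mod_cast h
    push_cast at this
    exact le_trans (by linarith) (le_abs_self _)
  · have : ((i + 2 : ℤ) : ℝ) ≤ (j + z * m : ℤ) := by exact_mod_cast (by omega)
    push_cast at this
    exact le_trans (by linarith) (neg_le_abs _)

theorem exists_eq_int_add (θ : AddCircle (m : ℝ)) :
    ∃ (i : ℤ) (u : ℝ), 0 ≤ u ∧ u < 1 ∧ θ = ((i + u : ℝ) : AddCircle (m : ℝ)) := by
  obtain ⟨x, rfl⟩ := QuotientAddGroup.mk_surjective θ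
  exact ⟨⌊x⌋, Int.fract x, Int.fract_nonneg x, Int.fract_lt_one x, by
    rw [Int.floor_add_fract]⟩

theorem add_one_ne_self (hm : 3 ≤ m) (i : ZMod m) : i + 1 ≠ i := by
  have : Fact (1 < m) := ⟨by omega⟩
  simp

theorem sum_eq_of_edge (hm : 3 ≤ m) [NeZero m] (i : ZMod m) {x : ZMod m → ℝ}
    (hx : ∀ k, k ≠ i → k ≠ i + 1 → x k = 0) : ∑ k, x k = x i + x (i + 1) := by
  rw [← Finset.sum_pair (add_one_ne_self hm i).symm]
  symm
  refine Finset.sum_subset (Finset.subset_univ _) fun k _ hk => ?_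
  simp only [Finset.mem_insert, Finset.mem_singleton, not_or] at hk
  exact hx k hk.1 hk.2

theorem tent_mem_realization (hm : 3 ≤ m) [NeZero m] (θ : AddCircle (m : ℝ)) :
    tent m θ ∈ (cycleComplex m).realization := by
  obtain ⟨i, u, h0, h1, rfl⟩ := exists_eq_int_add θ
  have hz := fun (k : ZMod m) (hk : k ≠ i) (hk' : k ≠ i + 1) => tent_eq_zero i h0 h1.le hk hk'
  refine ⟨⟨fun k => le_max_left _ _, ?_⟩, {(i : ZMod m), (i : ZMod m) + 1}, ⟨by simp, i, by simp⟩,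
    fun k hk => ?_⟩
  · rw [sum_eq_of_edge hm _ hz, tent_left hm i h0 h1.le, tent_right hm i h0 h1.le]; ring
  · by_contra h
    simp only [Finset.mem_insert, Finset.mem_singleton, not_or] at h
    exact hk (hz k h.1 h.2)

theorem tent_surjective (hm : 3 ≤ m) [NeZero m] {x : ZMod m → ℝ}
    (hx : x ∈ (cycleComplex m).realization) : ∃ θ, tent m θ = x := by
  obtain ⟨⟨h0, h1⟩, σ, ⟨-, i, hi⟩, hs⟩ := hx
  obtain ⟨j, rfl⟩ := ZMod.intCast_surjective i
  have hz : ∀ k : ZMod m, k ≠ j → k ≠ j + 1 → x k = 0 := fun k hk hk' => by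
    by_contra h
    exact (hi k (hs k h)).elim hk hk'
  rw [sum_eq_of_edge hm _ hz] at h1
  have hj := h0 (j : ZMod m)
  have hu := h0 ((j : ZMod m) + 1)
  have hu1 : x ((j : ZMod m) + 1) ≤ 1 := by linarith
  refine ⟨((j + x (j + 1) : ℝ) : AddCircle (m : ℝ)), ?_⟩
  ext k
  by_cases hk : k = j
  · rw [hk, tent_left hm j hu hu1]; linarith
  by_cases hk' : k = j + 1
  · rw [hk', tent_right hm j hu hu1]
  · rw [hz k hk hk', tent_eq_zero j hu hu1 hk hk']

/-- Since `u < 1`, the tent at the left endpoint is positive, so each left endpoint lies on the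
other point's edge. If they differed, 2 would vanish modulo `m`; once they agree, the value there
determines `u`. -/
theorem tent_injective (hm : 3 ≤ m) [NeZero m] : Function.Injective (tent m) := by
  intro θ θ' h
  obtain ⟨i, u, h0, h1, rfl⟩ := exists_eq_int_add θ
  obtain ⟨j, v, g0, g1, rfl⟩ := exists_eq_int_add θ'
  have hi : (i : ZMod m) = j ∨ (i : ZMod m) = j + 1 := by
    by_contra hc
    rw [not_or] at hc
    have := tent_left hm i h0 h1.le
    rw [h, tent_eq_zero j g0 g1.le hc.1 hc.2] at this
    linarith
  have hj : (j : ZMod m) = i ∨ (j : ZMod m) = i + 1 := by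
    by_contra hc
    rw [not_or] at hc
    have := tent_left hm j g0 g1.le
    rw [← h, tent_eq_zero i h0 h1.le hc.1 hc.2] at this
    linarith
  have hij : (i : ZMod m) = j := by
    rcases hi with hi | hi
    · exact hi
    rcases hj with hj | hj
    · exact hj.symm
    · exfalso
      rw [hi, add_assoc, one_add_one_eq_two, left_eq_add] at hj
      have : ((2 : ℕ) : ZMod m) = 0 := by exact_mod_cast hj
      rw [ZMod.natCast_eq_zero_iff] at this
      exact absurd (Nat.le_of_dvd two_pos this) (by omega)
  have huv : u = v := by
    have := tent_left hm i h0 h1.le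
    rw [h, hij, tent_left hm j g0 g1.le] at this
    linarith
  rw [huv, AddCircle.coe_add, AddCircle.coe_add, ← coe_val_intCast i, hij, coe_val_intCast]

/-- The realization of the cycle of length `m ≥ 3` is the circle of length `m`. -/
noncomputable def addCircleHomeomorph (hm : 3 ≤ m) [NeZero m] :
    AddCircle (m : ℝ) ≃ₜ (cycleComplex m).realization :=
  haveI : Fact (0 < (m : ℝ)) := ⟨by exact_mod_cast NeZero.pos m⟩
  Continuous.homeoOfEquivCompactToT2
    (f := Equiv.ofBijective (fun θ => ⟨tent m θ, tent_mem_realization hm θ⟩)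
      ⟨fun _ _ h => tent_injective hm (congrArg Subtype.val h),
        fun x => (tent_surjective hm x.2).imp fun _ h => Subtype.ext h⟩)
    (continuous_tent.subtype_mk _)

/-- The realization of the cycle of length `m ≥ 3` is a circle. -/
noncomputable def circleHomeomorph (hm : 3 ≤ m) [NeZero m] :
    (cycleComplex m).realization ≃ₜ Circle :=
  (addCircleHomeomorph hm).symm.trans
    (AddCircle.homeomorphCircle (by exact_mod_cast NeZero.ne m))

end cycleComplex

/-- The realization of the product of two cycles is a torus up to homotopy. -/
noncomputable def cycleComplexProdHomotopyEquiv {P Q : ℕ} [NeZero P] [NeZero Q] (hP : 3 ≤ P)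
    (hQ : 3 ≤ Q) :
    ContinuousMap.HomotopyEquiv ((cycleComplex P).prod (cycleComplex Q)).realization
      (Circle × Circle) :=
  ((cycleComplex P).realizationProdHomotopyEquiv (cycleComplex Q)).trans
    ((cycleComplex.circleHomeomorph hP).prodCongr
      (cycleComplex.circleHomeomorph hQ)).toHomotopyEquiv

/-! ### Neighborhoods as products of edges -/

theorem circulantGraphTwo_adj_iff {n s t : ℕ} (hs : (s : ZMod n) ≠ 0) (ht : (t : ZMod n) ≠ 0)
    (v w : ZMod n) : (circulantGraphTwo n s t).Adj v w ↔
      w = v - t ∨ w = v + s ∨ w = v - s ∨ w = v + t := by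
  simp only [circulantGraphTwo, SimpleGraph.circulantGraph, SimpleGraph.fromRel_adj,
    Set.mem_insert_iff, Set.mem_singleton_iff]
  constructor
  · rintro ⟨-, (h | h) | h | h⟩
    · exact .inr (.inr (.inl (by rw [← h]; ring)))
    · exact .inl (by rw [← h]; ring)
    · exact .inr (.inl (by rw [← h]; ring))
    · exact .inr (.inr (.inr (by rw [← h]; ring)))
  · rintro (rfl | rfl | rfl | rfl)
    · exact ⟨fun h => ht (sub_eq_self.1 h.symm), by simp⟩
    · exact ⟨by simpa using hs, by simp⟩
    · exact ⟨fun h => hs (sub_eq_self.1 h.symm), by simp⟩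
    · exact ⟨by simpa using ht, by simp⟩

/-- Coordinates on `ZMod n` in which the vectors `s + t` and `t - s` become the standard basis
identify the neighborhood complex of `C_n(s, t)` with a product of two cycles. -/
noncomputable def neighborhoodComplexHomeomorph {n s t P Q : ℕ} [NeZero n] [NeZero P] [NeZero Q]
    (hs : (s : ZMod n) ≠ 0) (ht : (t : ZMod n) ≠ 0) (e : ZMod n ≃+ ZMod P × ZMod Q)
    (he₁ : e (s + t) = (1, 0)) (he₂ : e (t - s) = (0, 1)) :
    (circulantGraphTwo n s t).neighborhoodComplex.realization ≃ₜ
      ((cycleComplex P).prod (cycleComplex Q)).realization := by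
  have key : ∀ v w : ZMod n, (circulantGraphTwo n s t).Adj v w ↔
      ((e w).1 = (e (v - t)).1 ∨ (e w).1 = (e (v - t)).1 + 1) ∧
      ((e w).2 = (e (v - t)).2 ∨ (e w).2 = (e (v - t)).2 + 1) := by
    intro v w
    have h1 : v + s = v - t + (s + t) := by ring
    have h2 : v - s = v - t + (t - s) := by ring
    have h3 : v + t = v - t + (s + t) + (t - s) := by ring
    rw [circulantGraphTwo_adj_iff hs ht, h1, h2, h3, ← e.injective.eq_iff, ← e.injective.eq_iff,
      ← e.injective.eq_iff, ← e.injective.eq_iff]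
    simp only [map_add, he₁, he₂, Prod.ext_iff, Prod.fst_add, Prod.snd_add, add_zero]
    tauto
  refine PreAbstractSimplicialComplex.realizationCongr e.toEquiv ?_ ?_
  · rintro σ ⟨hne, v, hv⟩
    refine ⟨by simpa using hne, {(e (v - t)).1, (e (v - t)).1 + 1}, ⟨by simp, (e (v - t)).1, by simp⟩,
      {(e (v - t)).2, (e (v - t)).2 + 1}, ⟨by simp, (e (v - t)).2, by simp⟩, fun c hc => ?_⟩
    obtain ⟨w, hw, rfl⟩ := Finset.mem_map.1 hc
    simpa using (key v w).1 (hv w hw)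
  · rintro σ ⟨hne, α, ⟨-, i, hi⟩, β, ⟨-, j, hj⟩, hσ⟩
    -- The lower corner of the neighborhood of `v` is `v - t`, so this vertex has its corner at `(i,
    -- j)`.
    refine ⟨by simpa using hne, e.symm (i, j) + t, fun w hw => ?_⟩
    obtain ⟨c, hc, rfl⟩ := Finset.mem_map.1 hw
    have := Finset.mem_product.1 (hσ hc)
    rw [key]
    simpa using ⟨hi _ this.1, hj _ this.2⟩

/-- If `a` is a unit modulo `P` and zero modulo `Q`, and `b` the other way round, then `a`, `b` is
the standard basis of `ZMod (P * Q)` in suitable coordinates. -/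
theorem exists_addEquiv_prod {n P Q : ℕ} (hn : n = P * Q) (hPQ : P.Coprime Q) (a b : ℤ)
    (haP : IsUnit (a : ZMod P)) (haQ : (a : ZMod Q) = 0) (hbP : (b : ZMod P) = 0)
    (hbQ : IsUnit (b : ZMod Q)) :
    ∃ e : ZMod n ≃+ ZMod P × ZMod Q, e a = (1, 0) ∧ e b = (0, 1) := by
  subst hn
  obtain ⟨u, hu⟩ := haP
  obtain ⟨v, hv⟩ := hbQ
  refine ⟨(ZMod.chineseRemainder hPQ).toAddEquiv.trans
    ((AddAut.mulLeft u⁻¹).prodCongr (AddAut.mulLeft v⁻¹)), ?_, ?_⟩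
  all_goals
    change ((↑u⁻¹ * (ZMod.chineseRemainder hPQ _).1, ↑v⁻¹ * (ZMod.chineseRemainder hPQ _).2) :
      ZMod P × ZMod Q) = _
    rw [map_intCast, Prod.fst_intCast, Prod.snd_intCast]
  · rw [haQ, ← hu, Units.inv_mul, mul_zero]
  · rw [hbP, ← hv, Units.inv_mul, mul_zero]

theorem isUnit_intCast_natAbs {a b : ℤ} (h : IsCoprime a b) : IsUnit (a : ZMod b.natAbs) := by
  obtain ⟨x, y, hxy⟩ := h
  have hb : (b : ZMod b.natAbs) = 0 :=
    (ZMod.intCast_zmod_eq_zero_iff_dvd b b.natAbs).2 (Int.natAbs_dvd.2 dvd_rfl)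
  have := congrArg (Int.cast : ℤ → ZMod b.natAbs) hxy
  push_cast at this
  rw [hb, mul_zero, add_zero, mul_comm] at this
  exact IsUnit.of_mul_eq_one _ this

theorem torus_of_coprime {n s t : ℕ} [NeZero n] {p q a b : ℤ} (hn : (n : ℤ) = p * q)
    (hpq : IsCoprime p q) (hs : (s : ZMod n) ≠ 0) (ht : (t : ZMod n) ≠ 0)
    (hp : 3 ≤ p.natAbs) (hq : 3 ≤ q.natAbs)
    (ha : a = s + t) (hb : b = t - s) (hpa : p ∣ a) (haq : IsCoprime a q) (hqb : q ∣ b)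
    (hbp : IsCoprime b p) :
    Nonempty (ContinuousMap.HomotopyEquiv
      (circulantGraphTwo n s t).neighborhoodComplex.realization (Circle × Circle)) := by
  have : NeZero p.natAbs := ⟨by omega⟩
  have : NeZero q.natAbs := ⟨by omega⟩
  -- The factor `q` comes first because `a` is a unit modulo `q` and vanishes modulo `p`.
  have hn' : n = q.natAbs * p.natAbs := by
    rw [mul_comm, ← Int.natAbs_mul, ← hn, Int.natAbs_natCast]
  obtain ⟨e, he₁, he₂⟩ := exists_addEquiv_prod hn' (Int.isCoprime_iff_gcd_eq_one.1 hpq.symm) a b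
    (isUnit_intCast_natAbs haq)
    ((ZMod.intCast_zmod_eq_zero_iff_dvd _ _).2 (Int.natAbs_dvd.2 hpa))
    ((ZMod.intCast_zmod_eq_zero_iff_dvd _ _).2 (Int.natAbs_dvd.2 hqb))
    (isUnit_intCast_natAbs hbp)
  rw [ha] at he₁
  rw [hb] at he₂
  push_cast at he₁ he₂
  exact ⟨(neighborhoodComplexHomeomorph hs ht e he₁ he₂).toHomotopyEquiv.trans
    (cycleComplexProdHomotopyEquiv hq hp)⟩

/-! ### Parity and size of the factors -/

theorem three_le_natAbs_of_odd {p : ℤ} (hp : Odd p) (h1 : p.natAbs ≠ 1) : 3 ≤ p.natAbs := by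
  have := Int.natAbs_odd.2 hp
  obtain ⟨k, hk⟩ := this
  omega

theorem odd_of_coprime_of_even_sub {p q : ℤ} (hpq : IsCoprime p q) (h : Even (p - q)) :
    Odd p ∧ Odd q := by
  have hiff := Int.even_sub.1 h
  have hp : Odd p := by
    rw [← Int.not_even_iff_odd]
    intro hp
    have h2 := hpq.isUnit_of_dvd' hp.two_dvd (hiff.1 hp).two_dvd
    exact absurd (Int.isUnit_iff.1 h2) (by decide)
  exact ⟨hp, by rwa [← Int.not_even_iff_odd, ← hiff, Int.not_even_iff_odd]⟩

theorem theorem3p7 (n : ℕ) [NeZero n] (p q : ℤ) (hn : (n : ℤ) = p * q) (hpq : Int.gcd p q = 1)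
    (s t : ℕ) (hs₁ : 1 ≤ s) (hs₂ : s < n) (ht₁ : 1 ≤ t) (ht₂ : t < n)
    (h2s : ¬ (2 * s : ℤ) ≡ 0 [ZMOD n]) (h2t : ¬ (2 * t : ℤ) ≡ 0 [ZMOD n])
    (h2st : ¬ (2 * (s + t) : ℤ) ≡ 0 [ZMOD n])
    (h3s_sub_t : ¬ (3 * s - t : ℤ) ≡ 0 [ZMOD n]) (h3t_sub_s : ¬ (3 * t - s : ℤ) ≡ 0 [ZMOD n])
    (h3s_add_t : ¬ (3 * s + t : ℤ) ≡ 0 [ZMOD n]) (h3t_add_s : ¬ (3 * t + s : ℤ) ≡ 0 [ZMOD n])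
    (h4s : ¬ (4 * s : ℤ) ≡ 0 [ZMOD n]) (h4t : ¬ (4 * t : ℤ) ≡ 0 [ZMOD n])
    (hst : ((s : ℚ) = ((p : ℚ) - q) / 2 ∧ (t : ℚ) = ((p : ℚ) + q) / 2) ∨
      ((s : ℚ) = ((p : ℚ) ^ 2 - q) / 2 ∧ (t : ℚ) = ((p : ℚ) ^ 2 + q) / 2)) :
    Nonempty (ContinuousMap.HomotopyEquiv
      (circulantGraphTwo n s t).neighborhoodComplex.realization (Circle × Circle)) := by
  have hcop : IsCoprime p q := Int.isCoprime_iff_gcd_eq_one.2 hpq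
  have hs : (s : ZMod n) ≠ 0 := fun h =>
    absurd (Nat.le_of_dvd hs₁ ((ZMod.natCast_eq_zero_iff _ _).1 h)) (by omega)
  have ht : (t : ZMod n) ≠ 0 := fun h =>
    absurd (Nat.le_of_dvd ht₁ ((ZMod.natCast_eq_zero_iff _ _).1 h)) (by omega)
  obtain ⟨a, ha, hb, hcase⟩ : ∃ a : ℤ, a = s + t ∧ q = t - s ∧ (a = p ∨ a = p ^ 2) := by
    rcases hst with ⟨h1, h2⟩ | ⟨h1, h2⟩
    · refine ⟨p, ?_, ?_, .inl rfl⟩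
      · have : (p : ℚ) = s + t := by rw [h1, h2]; ring
        exact_mod_cast this
      · have : (q : ℚ) = t - s := by rw [h1, h2]; ring
        exact_mod_cast this
    · refine ⟨p ^ 2, ?_, ?_, .inr rfl⟩
      · have : (p : ℚ) ^ 2 = s + t := by rw [h1, h2]; ring
        exact_mod_cast this
      · have : (q : ℚ) = t - s := by rw [h1, h2]; ring
        exact_mod_cast this
  have hpa : p ∣ a := by
    rcases hcase with rfl | rfl
    exacts [dvd_rfl, dvd_pow_self p two_ne_zero]
  have haq : IsCoprime a q := by
    rcases hcase with rfl | rfl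
    exacts [hcop, hcop.pow_left]
  have hodd : Odd p ∧ Odd q := by
    have h := odd_of_coprime_of_even_sub haq ⟨s, by rw [ha, hb]; ring⟩
    refine ⟨?_, h.2⟩
    rcases hcase with rfl | rfl
    exacts [h.1, Int.odd_pow.1 h.1 |>.resolve_right two_ne_zero]
  -- If `p = ±1`, then `n` divides `q = t - s`, which is nonzero and smaller than `n` in absolute
  -- value.
  have hp1 : p.natAbs ≠ 1 := by
    intro h
    have hq : (n : ℤ) ∣ q := by
      rw [hn]
      exact (Int.isUnit_iff_natAbs_eq.2 h).mul_left_dvd.2 dvd_rfl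
    have hq0 : q ≠ 0 := by rintro rfl; simpa using hodd.2
    have := Int.le_of_dvd (abs_pos.2 hq0) ((dvd_abs _ _).2 hq)
    rcases abs_cases q with h | h <;> omega
  -- If `q = ±1`, then `n = ±p` divides `a = s + t`, so `2 * (s + t)` vanishes modulo `n`.
  have hq1 : q.natAbs ≠ 1 := by
    intro h
    apply h2st
    rw [Int.modEq_zero_iff_dvd, ← ha, hn]
    exact (((Int.isUnit_iff_natAbs_eq.2 h).mul_right_dvd).2 hpa).mul_left _
  exact torus_of_coprime hn hcop hs ht (three_le_natAbs_of_odd hodd.1 hp1)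
    (three_le_natAbs_of_odd hodd.2 hq1) ha hb hpa haq dvd_rfl hcop.symm
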